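/- **Theorem 1.** For every $\varepsilon\in(0,\frac12)$ there is an $n_0=n_0(\varepsilon)$ such that the following holds for every integer $n>n_0$. Let $G=G(A,B)$ and $H=H(S,T)$ be simple bipartite graphs with vertex classes $A,B$ and $S,T$, respectively, where $|A|=|B|=|S|=|T|=n$. Suppose that 1. $d_G(x)>\left(\frac12+\varepsilon\right)n$ for all $x\in A\cup B$, 2. $d_H(x)<\frac{\varepsilon^4}{100}\cdot\frac{n}{\log n}$ for all $x\in S$ (where $\log$ is the natural logarithm), 3. $d_H(y)=1$ for all $y\in T$. Then $H\subseteq G$: there is an injective map from $S\cup T$ to $A\cup B$ that takes $S$ to $A$, $T$ to $B$ and every edge of $H$ to an edge of $G$. Equivalently, $H$ and the bipartite complement $\overline G$ of $G$ (with classes $A,B$, in which $a\in A$ and $b\in B$ are adjacent if and only if $ab$ is not an edge of $G$) pack in the bipartite sense: the complete bipartite graph $K_{n,n}$ contains edge-disjoint copies of $H$ and $\overline G$, with $S$ and $A$ placed in the first class and $T$ and $B$ in the second. -/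

import Mathlib

namespace BipartitePacking

universe u v

/-- `G(A, B)`: the simple graph `G` is bipartite with vertex classes `A` and `B`, that is,
`A` and `B` are disjoint, every edge joins `A` to `B`, and `A ∪ B` is the whole vertex set. -/
def IsBigraph {V : Type u} (G : SimpleGraph V) (A B : Finset V) : Prop :=
  G.IsBipartiteWith (A : Set V) (B : Set V) ∧ (A : Set V) ∪ (B : Set V) = Set.univ

/-- The complement of `G(A, B)` in the complete bipartite graph with classes `A` and `B`. -/
def bipartiteCompl {V : Type u} (G : SimpleGraph V) (A B : Finset V) : SimpleGraph V :=
  SimpleGraph.fromRel (fun x y => x ∈ A ∧ y ∈ B) \ G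

/-- `H(S, T)` is a subgraph of `G(A, B)`: there is a copy of `H` in `G` (an injective map of the
vertices sending edges to edges) that takes `S` into `A` and `T` into `B`. -/
def IsBipartiteSubgraph {V : Type u} {W : Type v} (H : SimpleGraph W) (S T : Finset W)
    (G : SimpleGraph V) (A B : Finset V) : Prop :=
  ∃ f : SimpleGraph.Copy H G, (∀ s ∈ S, f s ∈ A) ∧ (∀ t ∈ T, f t ∈ B)

/-- The bipartite graphs `G₁(A, B)` and `G₂(S, T)`, with `|A| = |S| = m` and `|B| = |T| = n`,
pack in the bipartite sense: the complete bipartite graph `K_{m,n}` contains edge-disjoint copies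
of them, placed with `A`, `S` in the class of size `m` and `B`, `T` in the class of size `n`. -/
def BipartitePack {V : Type u} {W : Type v} (G₁ : SimpleGraph V) (A B : Finset V)
    (G₂ : SimpleGraph W) (S T : Finset W) (m n : ℕ) : Prop :=
  ∃ (f : SimpleGraph.Copy G₁ (completeBipartiteGraph (Fin m) (Fin n)))
    (g : SimpleGraph.Copy G₂ (completeBipartiteGraph (Fin m) (Fin n))),
    (∀ a ∈ A, (f a).isLeft) ∧ (∀ b ∈ B, (f b).isRight) ∧
    (∀ s ∈ S, (g s).isLeft) ∧ (∀ t ∈ T, (g t).isRight) ∧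
    ∀ x y x' y', G₁.Adj x y → G₂.Adj x' y' → s(f x, f y) ≠ s(g x', g y')

end BipartitePacking

/-! Since every vertex of `T` has degree one, `H` is a union of stars centred in `S`. The centres
are placed by a uniformly random bijection `φ : S ≃ A`. For fixed `b`, the number of leaves that
cannot go to `b` is the total degree of the centres sent to non-neighbours of `b`; its mean is at
most `(1/2 - ε) n`. The events that centres land in a fixed set are negatively correlated, so the
exponential moment is at most that of independent placement. Small star sizes then give a Chernoff
bound strong enough for a union bound over the `n` vertices `b`, and some `φ` leaves every `b` open
to at least half of the leaves (`exists_equiv_weight_le_half`). Each leaf is open to more than half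
of `B`, so Hall's theorem places the leaves. -/

namespace BipartitePacking

open Finset

/-! ### Negative correlation and exponential moments for random bijections -/

/-- Constraining one more point of a uniformly random bijection to land in `M` costs at least a
factor `#M / card S`. -/
theorem card_equiv_insert_mul_le {S A : Type*} [Fintype S] [Fintype A] [DecidableEq S]
    [DecidableEq A] (M : Finset A) (hM : #M ≤ Fintype.card S) {X : Finset S} {s : S} (hs : s ∉ X) :
    #{φ : S ≃ A | ∀ x ∈ insert s X, φ x ∈ M} * Fintype.card S ≤
      #M * #{φ : S ≃ A | ∀ x ∈ X, φ x ∈ M} := by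
  classical
  -- Precomposing with the transposition of `s` and `t` fixes `X`, so all choices of the new point
  -- are equivalent.
  have hsym : ∀ t ∈ Xᶜ, #{φ : S ≃ A | ∀ x ∈ insert t X, φ x ∈ M} =
      #{φ : S ≃ A | ∀ x ∈ insert s X, φ x ∈ M} := by
    intro t ht
    rw [mem_compl] at ht
    have hfix : ∀ x ∈ X, Equiv.swap s t x = x := fun x hx =>
      Equiv.swap_apply_of_ne_of_ne (fun h => hs (h ▸ hx)) (fun h => ht (h ▸ hx))
    refine card_bij' (fun φ _ => (Equiv.swap s t).trans φ) (fun φ _ => (Equiv.swap s t).trans φ)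
      ?_ ?_ ?_ ?_
    · intro φ hφ
      simp only [mem_filter, mem_univ, true_and, mem_insert, forall_eq_or_imp,
        Equiv.trans_apply, Equiv.swap_apply_left] at hφ ⊢
      exact ⟨hφ.1, fun x hx => by rw [hfix x hx]; exact hφ.2 x hx⟩
    · intro φ hφ
      simp only [mem_filter, mem_univ, true_and, mem_insert, forall_eq_or_imp,
        Equiv.trans_apply, Equiv.swap_apply_right] at hφ ⊢
      exact ⟨hφ.1, fun x hx => by rw [hfix x hx]; exact hφ.2 x hx⟩
    · intro φ _; ext x; simp
    · intro φ _; ext x; simp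
  have hcount : ∀ φ ∈ ({φ : S ≃ A | ∀ x ∈ X, φ x ∈ M} : Finset (S ≃ A)),
      #{t ∈ Xᶜ | φ t ∈ M} + #X = #M := by
    intro φ hφ
    simp only [mem_filter, mem_univ, true_and] at hφ
    have h1 : #{t : S | φ t ∈ M} = #M := by
      refine card_bij (fun t _ => φ t) (by simp) (by simp) ?_
      intro a ha
      exact ⟨φ.symm a, by simpa using ha, by simp⟩
    rw [← h1, ← card_union_of_disjoint]
    · congr 1
      ext t
      simp only [mem_union, mem_filter, mem_compl, mem_univ, true_and]
      by_cases ht : t ∈ X <;> simp [ht, hφ]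
    · rw [disjoint_left]
      intro t ht
      simp only [mem_filter, mem_compl] at ht
      exact ht.1
  -- Double count pairs `(t, φ)` with `t` outside `X`.
  have hdouble : (Fintype.card S - #X) * #{φ : S ≃ A | ∀ x ∈ insert s X, φ x ∈ M} =
      ∑ φ ∈ ({φ : S ≃ A | ∀ x ∈ X, φ x ∈ M} : Finset (S ≃ A)), #{t ∈ Xᶜ | φ t ∈ M} := by
    rw [← card_compl, ← smul_eq_mul, ← sum_const, ← sum_congr rfl hsym]
    simp only [card_filter]
    rw [sum_comm' (t' := univ) (s' := fun _ => Xᶜ) (by simp), sum_filter]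
    refine sum_congr rfl fun φ _ => ?_
    split_ifs with h
    · refine sum_congr rfl fun t _ => ?_
      simp only [mem_insert, forall_eq_or_imp]
      exact if_congr (and_iff_left h) rfl rfl
    · refine sum_eq_zero fun t _ => if_neg fun h' => h fun x hx => h' x (mem_insert_of_mem hx)
  have hX : #X < Fintype.card S := by
    rw [← card_univ]
    exact card_lt_card (ssubset_univ_iff.2 fun h => hs (h ▸ mem_univ s))
  -- A witness `φ` is what gives `#X ≤ #M`; without it the subtraction `#M - #X` could truncate.
  rcases Nat.eq_zero_or_pos #{φ : S ≃ A | ∀ x ∈ X, φ x ∈ M} with h0 | hpos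
  · have : #{φ : S ≃ A | ∀ x ∈ insert s X, φ x ∈ M} ≤ #{φ : S ≃ A | ∀ x ∈ X, φ x ∈ M} :=
      card_le_card fun φ hφ => by
        simp only [mem_filter, mem_univ, true_and] at hφ ⊢
        exact fun x hx => hφ x (mem_insert_of_mem hx)
    rw [h0, Nat.le_zero] at this
    rw [this, h0]; simp
  · obtain ⟨φ, hφ⟩ := card_pos.1 hpos
    have hXM : #X ≤ #M := by have := hcount φ hφ; omega
    have hsum : (Fintype.card S - #X) * #{φ : S ≃ A | ∀ x ∈ insert s X, φ x ∈ M} =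
        (#M - #X) * #{φ : S ≃ A | ∀ x ∈ X, φ x ∈ M} := by
      rw [hdouble, sum_congr rfl fun φ hφ => (Nat.eq_sub_of_add_eq (hcount φ hφ)), sum_const,
        smul_eq_mul, mul_comm]
    generalize #{φ : S ≃ A | ∀ x ∈ insert s X, φ x ∈ M} = P at *
    generalize #{φ : S ≃ A | ∀ x ∈ X, φ x ∈ M} = Q at *
    obtain ⟨u, hu⟩ := Nat.exists_eq_add_of_le hXM
    obtain ⟨v, hv⟩ := Nat.exists_eq_add_of_lt hX
    rw [hu, hv] at hsum hM ⊢
    have huv : u ≤ v + 1 := by omega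
    have e1 : #X + v + 1 - #X = v + 1 := by omega
    have e2 : #X + u - #X = u := by omega
    rw [e1, e2] at hsum
    have hPQ : P ≤ Q := by
      by_contra! h
      have := Nat.mul_le_mul huv (le_refl Q)
      nlinarith
    nlinarith [Nat.mul_le_mul (le_refl #X) hPQ]

/-- The events `φ x ∈ M` of a uniformly random bijection `φ` are negatively correlated. -/
theorem card_equiv_forall_mem_le {S A : Type*} [Fintype S] [Fintype A] [DecidableEq S]
    [DecidableEq A] (M : Finset A) (hM : #M ≤ Fintype.card S) (X : Finset S) :
    (#{φ : S ≃ A | ∀ x ∈ X, φ x ∈ M} : ℝ) ≤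
      Fintype.card (S ≃ A) * ((#M : ℝ) / Fintype.card S) ^ #X := by
  induction X using Finset.induction_on with
  | empty => simp
  | insert s X hs ih =>
    have hS : (0 : ℝ) < Fintype.card S := by exact_mod_cast Fintype.card_pos_iff.2 ⟨s⟩
    have h : (#{φ : S ≃ A | ∀ x ∈ insert s X, φ x ∈ M} : ℝ) * Fintype.card S ≤
        #M * #{φ : S ≃ A | ∀ x ∈ X, φ x ∈ M} := by
      exact_mod_cast card_equiv_insert_mul_le M hM hs
    rw [card_insert_of_notMem hs, pow_succ, ← mul_assoc]
    calc _ ≤ (#M : ℝ) * #{φ : S ≃ A | ∀ x ∈ X, φ x ∈ M} / Fintype.card S := (le_div_iff₀ hS).2 h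
      _ = #{φ : S ≃ A | ∀ x ∈ X, φ x ∈ M} * ((#M : ℝ) / Fintype.card S) := by ring
      _ ≤ _ := by gcongr

/-- Expanding both products over subsets `X` of `S` reduces the bound, term by term, to
`card_equiv_forall_mem_le`; nonnegative coefficients preserve the inequality. -/
theorem sum_equiv_prod_one_add_le {S A : Type*} [Fintype S] [Fintype A] [DecidableEq S]
    [DecidableEq A] (M : Finset A) (hM : #M ≤ Fintype.card S) (c : S → ℝ) (hc : ∀ s, 0 ≤ c s) :
    ∑ φ : S ≃ A, ∏ s, (1 + if φ s ∈ M then c s else 0) ≤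
      Fintype.card (S ≃ A) * ∏ s, (1 + c s * ((#M : ℝ) / Fintype.card S)) := by
  simp only [prod_one_add]
  rw [sum_comm, mul_sum]
  refine sum_le_sum fun X _ => ?_
  have h : ∀ φ : S ≃ A, ∏ s ∈ X, (if φ s ∈ M then c s else 0) =
      if ∀ x ∈ X, φ x ∈ M then ∏ s ∈ X, c s else 0 := by
    intro φ
    split_ifs with h
    · exact prod_congr rfl fun x hx => if_pos (h x hx)
    · push Not at h
      obtain ⟨x, hx, hxM⟩ := h
      exact prod_eq_zero hx (if_neg hxM)
  simp only [h]
  rw [← sum_filter, sum_const, nsmul_eq_mul, prod_mul_distrib, prod_const, mul_left_comm,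
    mul_comm (∏ s ∈ X, c s)]
  exact mul_le_mul_of_nonneg_right (card_equiv_forall_mem_le M hM X)
    (prod_nonneg fun s _ => hc s)

/-- Exponential moment of the weight that a uniformly random bijection puts on `M`. -/
theorem sum_equiv_exp_le {S A : Type*} [Fintype S] [Fintype A] [DecidableEq S]
    [DecidableEq A] (M : Finset A) (hM : #M ≤ Fintype.card S) (w : S → ℝ) (δ : ℝ)
    (hδ : δ ≤ 1) (hw : ∀ s, 0 ≤ w s) (hwδ : ∀ s, w s ≤ δ) :
    ∑ φ : S ≃ A, Real.exp (∑ s with φ s ∈ M, w s) ≤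
      Fintype.card (S ≃ A) *
        Real.exp ((#M : ℝ) / Fintype.card S * ((1 + δ) * ∑ s, w s)) := by
  have h1 : ∀ φ : S ≃ A, Real.exp (∑ s with φ s ∈ M, w s) =
      ∏ s, (1 + if φ s ∈ M then Real.exp (w s) - 1 else 0) := by
    intro φ
    rw [sum_filter, Real.exp_sum]
    refine prod_congr rfl fun s _ => ?_
    split_ifs <;> simp
  simp only [h1]
  refine (sum_equiv_prod_one_add_le M hM _ fun s => ?_).trans ?_
  · linarith [Real.one_le_exp (hw s)]
  · refine mul_le_mul_of_nonneg_left ?_ (Nat.cast_nonneg _)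
    rw [mul_sum, mul_sum, Real.exp_sum]
    refine prod_le_prod (fun s _ => ?_) fun s _ => ?_
    · have := Real.one_le_exp (hw s)
      have : 0 ≤ Real.exp (w s) - 1 := by linarith
      positivity
    · have hp : (0 : ℝ) ≤ (#M : ℝ) / Fintype.card S := by positivity
      -- From `|exp w - 1 - w| ≤ w ^ 2` and `w ^ 2 ≤ δ w`.
      have he : Real.exp (w s) - 1 ≤ (1 + δ) * w s := by
        have := Real.abs_exp_sub_one_sub_id_le (x := w s)
          (by rw [abs_of_nonneg (hw s)]; exact (hwδ s).trans hδ)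
        have := (abs_le.1 this).2
        nlinarith [hw s, hwδ s]
      calc 1 + (Real.exp (w s) - 1) * ((#M : ℝ) / Fintype.card S)
          ≤ (#M : ℝ) / Fintype.card S * ((1 + δ) * w s) + 1 := by nlinarith
        _ ≤ _ := Real.add_one_le_exp _

/-! ### Placing the centres, then the leaves -/

/-- If each vertex of `B` has few non-neighbours in `A`, then some bijection `S ≃ A` puts at most
half of the total weight on the non-neighbours of each vertex of `B`. -/
theorem exists_equiv_weight_le_half {S A B : Type*} [Fintype S] [Fintype A] [Fintype B]
    [DecidableEq S] [DecidableEq A] {n : ℕ} (hn : 1 < n) (hS : Fintype.card S = n)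
    (hA : Fintype.card A = n) (hB : Fintype.card B = n) {ε : ℝ} (hε0 : 0 < ε) (hε1 : ε < 1 / 2)
    (M : B → Finset A) (hM : ∀ b, (#(M b) : ℝ) ≤ (1 / 2 - ε) * n) (d : S → ℝ) (hd0 : ∀ s, 0 ≤ d s)
    (hd : ∀ s, d s ≤ ε ^ 4 / 100 * ((n : ℝ) / Real.log n)) (hsum : ∑ s, d s = n) :
    ∃ φ : S ≃ A, ∀ b, ∑ s with φ s ∈ M b, d s ≤ n / 2 := by
  by_contra! hcon
  have hn0 : (0 : ℝ) < n := by positivity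
  have hn1 : (1 : ℝ) < n := by exact_mod_cast hn
  have hlog : 0 < Real.log n := Real.log_pos hn1
  -- The Chernoff parameter is chosen so that the degree bound becomes exactly `r * d s ≤ ε`.
  obtain ⟨r, hr⟩ : ∃ r : ℝ, r = 100 * Real.log n / (ε ^ 3 * n) := ⟨_, rfl⟩
  have hr0 : 0 < r := by rw [hr]; positivity
  have hrd : ∀ s, r * d s ≤ ε := fun s => by
    calc r * d s ≤ r * (ε ^ 4 / 100 * ((n : ℝ) / Real.log n)) := by gcongr; exact hd s
      _ = ε := by rw [hr]; field_simp
  have hN : (0 : ℝ) < Fintype.card (S ≃ A) := by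
    exact_mod_cast Fintype.card_pos_iff.2 ⟨Fintype.equivOfCardEq (hS.trans hA.symm)⟩
  have hupper : ∀ b, ∑ φ : S ≃ A, Real.exp (∑ s with φ s ∈ M b, r * d s) ≤
      Fintype.card (S ≃ A) * Real.exp ((1 / 2 - ε) * ((1 + ε) * (r * n))) := by
    intro b
    have hcard : #(M b) ≤ Fintype.card S := by
      rw [hS, ← hA]; exact card_le_univ _
    refine (sum_equiv_exp_le (M b) hcard (fun s => r * d s) ε (by linarith)
      (fun s => mul_nonneg hr0.le (hd0 s)) hrd).trans ?_
    rw [← mul_sum, hsum, hS]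
    have : (#(M b) : ℝ) / n ≤ 1 / 2 - ε := (div_le_iff₀ hn0).2 (hM b)
    gcongr
  have hlower : (Fintype.card (S ≃ A) : ℝ) * Real.exp (r * n / 2) ≤
      ∑ φ : S ≃ A, ∑ b, Real.exp (∑ s with φ s ∈ M b, r * d s) := by
    rw [← nsmul_eq_mul, ← card_univ, ← sum_const]
    refine sum_le_sum fun φ _ => ?_
    obtain ⟨b, hb⟩ := hcon φ
    calc Real.exp (r * n / 2) ≤ Real.exp (∑ s with φ s ∈ M b, r * d s) := by
          rw [Real.exp_le_exp, ← mul_sum]; nlinarith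
      _ ≤ _ := single_le_sum (f := fun b => Real.exp (∑ s with φ s ∈ M b, r * d s))
          (fun b _ => (Real.exp_pos _).le) (mem_univ b)
  -- Union bound: after dividing by the number of bijections and taking logarithms, `r n / 2 ≤ log n
  -- + (1/2 - ε)(1 + ε) r n`. The gap `(ε/2 + ε ^ 2) r n` exceeds `log n`, a contradiction.
  rw [sum_comm] at hlower
  have htotal := hlower.trans (sum_le_sum fun b _ => hupper b)
  rw [sum_const, card_univ, hB, nsmul_eq_mul, mul_left_comm, mul_le_mul_iff_right₀ hN,
    ← Real.exp_log hn0, ← Real.exp_add, Real.exp_le_exp, Real.exp_log hn0] at htotal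
  have hrn : r * n = 100 * Real.log n / ε ^ 3 := by rw [hr]; field_simp
  have hlarge : Real.log n < ε / 2 * (r * n) := by
    have : ε / 2 * (r * n) = 50 * Real.log n / ε ^ 2 := by rw [hrn]; field_simp; ring
    have hsq : ε ^ 2 < 1 := by nlinarith
    rw [this, lt_div_iff₀ (by positivity)]
    nlinarith
  have hpos : 0 < r * n := by positivity
  nlinarith [mul_pos (mul_pos hε0 hε0) hpos]

/-- Hall's theorem for a balanced relation of minimum degree at least half the size of a class. -/
theorem exists_injective_of_half_le_degree {T B : Type*} [Fintype T] [Fintype B] {n : ℕ}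
    (hT : Fintype.card T = n) (hB : Fintype.card B = n) (Q : T → B → Prop)
    [∀ t b, Decidable (Q t b)]
    (hQT : ∀ t, n < 2 * #{b | Q t b}) (hQB : ∀ b, n ≤ 2 * #{t | Q t b}) :
    ∃ ψ : T → B, Function.Injective ψ ∧ ∀ t, Q t (ψ t) := by
  classical
  obtain ⟨ψ, hψ, h⟩ := (all_card_le_biUnion_card_iff_exists_injective
    (fun t => ({b | Q t b} : Finset B))).1 (by
      intro X
      rcases X.eq_empty_or_nonempty with rfl | ⟨t, ht⟩
      · simp
      have h1 : #{b | Q t b} ≤ #(X.biUnion fun t => ({b | Q t b} : Finset B)) :=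
        card_le_card (subset_biUnion_of_mem (fun t => ({b | Q t b} : Finset B)) ht)
      have h2 := hQT t
      -- One neighbourhood suffices for a small `X`; a larger `X` meets the neighbourhood of every
      -- `b`, so its own neighbourhood is all of `B`.
      by_cases hX : 2 * #X ≤ n
      · omega
      · have hall : X.biUnion (fun t => ({b | Q t b} : Finset B)) = univ := by
          refine eq_univ_iff_forall.2 fun b => ?_
          obtain ⟨t', ht'⟩ : (X ∩ ({t | Q t b} : Finset T)).Nonempty := by
            rw [← card_pos]
            have := card_union_add_card_inter X {t | Q t b}
            have := card_le_univ (X ∪ ({t | Q t b} : Finset T))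
            have := hQB b
            omega
          simp only [mem_inter, mem_filter, mem_univ, true_and] at ht'
          simpa using ⟨t', ht'⟩
        rw [hall, card_univ, hB, ← hT]
        exact card_le_univ X)
  exact ⟨ψ, hψ, fun t => by simpa using h t⟩

/-- A balanced relation of large minimum degree contains every spanning system of stars
(`c t` is the centre of the star of `t`) of small maximum degree. -/
theorem exists_star_embedding {S T A B : Type*} [Fintype S] [Fintype T] [Fintype A] [Fintype B]
    [DecidableEq S] {n : ℕ} (hn : 1 < n) (hS : Fintype.card S = n) (hT : Fintype.card T = n)
    (hA : Fintype.card A = n) (hB : Fintype.card B = n) {ε : ℝ} (hε0 : 0 < ε) (hε1 : ε < 1 / 2)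
    (R : A → B → Prop) [∀ a b, Decidable (R a b)]
    (hRA : ∀ a, (1 / 2 + ε) * n < (#{b | R a b} : ℝ))
    (hRB : ∀ b, (1 / 2 + ε) * n < (#{a | R a b} : ℝ))
    (c : T → S) (hc : ∀ s, (#{t | c t = s} : ℝ) ≤ ε ^ 4 / 100 * ((n : ℝ) / Real.log n)) :
    ∃ (φ : S ≃ A) (ψ : T → B), Function.Injective ψ ∧ ∀ t, R (φ (c t)) (ψ t) := by
  classical
  have hn0 : (0 : ℝ) < n := by positivity
  obtain ⟨φ, hφ⟩ := exists_equiv_weight_le_half hn hS hA hB hε0 hε1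
    (fun b => ({a | ¬ R a b} : Finset A))
    (by
      intro b
      have h : #{a | R a b} + #{a | ¬ R a b} = n := by
        rw [card_filter_add_card_filter_not, card_univ, hA]
      have h' : (#{a | R a b} : ℝ) + #{a | ¬ R a b} = n := by exact_mod_cast h
      linarith [hRB b])
    (fun s => (#{t | c t = s} : ℝ)) (fun s => Nat.cast_nonneg _) hc
    (by
      rw [← Nat.cast_sum, ← card_eq_sum_card_fiberwise (fun t _ => mem_univ (c t)), card_univ, hT])
  refine ⟨φ, exists_injective_of_half_le_degree hT hB (fun t b => R (φ (c t)) b) ?_ ?_⟩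
  · intro t
    have := hRA (φ (c t))
    have : (n : ℝ) < 2 * #{b | R (φ (c t)) b} := by nlinarith
    exact_mod_cast this
  · intro b
    have h1 : ∑ s with φ s ∈ ({a | ¬ R a b} : Finset A), #{t | c t = s} =
        #{t | ¬ R (φ (c t)) b} := by
      rw [card_eq_sum_card_fiberwise (f := c) (s := {t | ¬ R (φ (c t)) b})
        (t := ({s | φ s ∈ ({a | ¬ R a b} : Finset A)} : Finset S)) (by intro t; simp)]
      refine sum_congr rfl fun s hs => ?_
      rw [filter_filter]
      congr 1
      ext t
      simp only [mem_filter, mem_univ, true_and] at hs ⊢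
      exact ⟨fun h => ⟨h ▸ hs, h⟩, fun h => h.2⟩
    have h2 := hφ b
    rw [← Nat.cast_sum, h1] at h2
    have h3 : #{t | R (φ (c t)) b} + #{t | ¬ R (φ (c t)) b} = n := by
      rw [card_filter_add_card_filter_not, card_univ, hT]
    have h3' : (#{t | R (φ (c t)) b} : ℝ) + #{t | ¬ R (φ (c t)) b} = n := by exact_mod_cast h3
    have : (n : ℝ) ≤ 2 * #{t | R (φ (c t)) b} := by linarith
    exact_mod_cast this

/-! ### Transfer to bipartite graphs and packings -/

namespace IsBigraph

variable {V : Type*} {G : SimpleGraph V} {A B : Finset V}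

theorem mem_or_mem (h : IsBigraph G A B) (x : V) : x ∈ A ∨ x ∈ B := by
  have : x ∈ (A : Set V) ∪ (B : Set V) := h.2 ▸ Set.mem_univ x
  simpa using this

theorem notMem_right (h : IsBigraph G A B) {x : V} (hx : x ∈ A) : x ∉ B := fun hB =>
  Set.disjoint_left.1 h.1.disjoint (mem_coe.2 hx) (mem_coe.2 hB)

theorem symm (h : IsBigraph G A B) : IsBigraph G B A :=
  ⟨h.1.symm, by rw [Set.union_comm]; exact h.2⟩

theorem mem_right_of_adj (h : IsBigraph G A B) {x y : V} (hx : x ∈ A) (hxy : G.Adj x y) :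
    y ∈ B :=
  mem_coe.1 (h.1.mem_of_mem_adj (mem_coe.2 hx) hxy)

theorem card_filter_adj [Fintype V] [DecidableRel G.Adj] (h : IsBigraph G A B) {x : V}
    (hx : x ∈ A) : #{y : B | G.Adj x y} = G.degree x := by
  rw [← G.card_neighborFinset_eq_degree]
  refine card_bij (fun y _ => (y : V)) (by simp) (fun _ _ _ _ => Subtype.ext) ?_
  intro y hy
  rw [SimpleGraph.mem_neighborFinset] at hy
  exact ⟨⟨y, h.mem_right_of_adj hx hy⟩, by simpa using hy, rfl⟩

/-- The vertices of a balanced bipartite graph, listed class by class. -/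
theorem exists_injective_sum (h : IsBigraph G A B) {n : ℕ} (hA : #A = n) (hB : #B = n) :
    ∃ e : V → Fin n ⊕ Fin n, Function.Injective e ∧ (∀ a ∈ A, (e a).isLeft) ∧
      ∀ b ∈ B, (e b).isRight := by
  classical
  let eA := A.equivFinOfCardEq hA
  let eB := B.equivFinOfCardEq hB
  refine ⟨fun x => if hx : x ∈ A then Sum.inl (eA ⟨x, hx⟩)
    else Sum.inr (eB ⟨x, (h.mem_or_mem x).resolve_left hx⟩), ?_, ?_, ?_⟩
  · intro x y hxy
    by_cases hx : x ∈ A <;> by_cases hy : y ∈ A <;> simp [hx, hy] at hxy <;> exact hxy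
  · intro a ha; simp [ha]
  · intro b hb; simp [h.symm.notMem_right hb]

/-- A map that respects the vertex classes is a copy in the complete bipartite graph. -/
theorem adj_completeBipartiteGraph (h : IsBigraph G A B) {α β : Type*} {e : V → α ⊕ β}
    (hA : ∀ a ∈ A, (e a).isLeft) (hB : ∀ b ∈ B, (e b).isRight) {x y : V} (hxy : G.Adj x y) :
    (completeBipartiteGraph α β).Adj (e x) (e y) := by
  rw [completeBipartiteGraph_adj]
  rcases h.mem_or_mem x with hx | hx
  · exact Or.inl ⟨hA x hx, hB y (h.mem_right_of_adj hx hxy)⟩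
  · exact Or.inr ⟨hB x hx, hA y (h.symm.mem_right_of_adj hx hxy)⟩

theorem bipartiteCompl (h : IsBigraph G A B) : IsBigraph (bipartiteCompl G A B) A B := by
  refine ⟨⟨h.1.disjoint, fun x y hxy => ?_⟩, h.2⟩
  simp only [BipartitePacking.bipartiteCompl, SimpleGraph.sdiff_adj, SimpleGraph.fromRel_adj] at hxy
  rcases hxy.1.2 with h' | h'
  · exact Or.inl ⟨mem_coe.2 h'.1, mem_coe.2 h'.2⟩
  · exact Or.inr ⟨mem_coe.2 h'.2, mem_coe.2 h'.1⟩

end IsBigraph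

/-- A bipartite subgraph of `G` packs with the bipartite complement of `G`. -/
theorem IsBipartiteSubgraph.bipartitePack {V W : Type*} {G : SimpleGraph V} {A B : Finset V}
    {H : SimpleGraph W} {S T : Finset W} {n : ℕ} (hG : IsBigraph G A B) (hH : IsBigraph H S T)
    (hA : #A = n) (hB : #B = n) (h : IsBipartiteSubgraph H S T G A B) :
    BipartitePack H S T (bipartiteCompl G A B) A B n n := by
  obtain ⟨f, hfS, hfT⟩ := h
  obtain ⟨e, he, heA, heB⟩ := hG.exists_injective_sum hA hB
  refine ⟨⟨⟨fun x => e (f x), fun {x y} hxy => ?_⟩, fun x y hxy => f.injective (he hxy)⟩,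
    ⟨⟨e, fun {x y} hxy => hG.bipartiteCompl.adj_completeBipartiteGraph heA heB hxy⟩, he⟩,
    fun s hs => heA _ (hfS s hs), fun t ht => heB _ (hfT t ht), heA, heB, ?_⟩
  · exact hH.adj_completeBipartiteGraph (e := fun x => e (f x)) (fun s hs => heA _ (hfS s hs))
      (fun t ht => heB _ (hfT t ht)) hxy
  · intro x y x' y' hxy hxy' heq
    have hne : ¬ G.Adj x' y' := hxy'.2
    have hf : G.Adj (f x) (f y) := f.toHom.map_adj hxy
    have heq' : s(e (f x), e (f y)) = s(e x', e y') := heq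
    rcases Sym2.eq_iff.1 heq' with ⟨h1, h2⟩ | ⟨h1, h2⟩
    · exact hne (he h1 ▸ he h2 ▸ hf)
    · exact hne (he h1 ▸ he h2 ▸ hf.symm)

/-- Sending each vertex of `T` to its only neighbour encodes `H` as a centre map `c : T → S` whose
fibres have the degrees in `S` as sizes, so `exists_star_embedding` applies. -/
theorem isBipartiteSubgraph_of_degree {V W : Type*} [Fintype V] [Fintype W] {G : SimpleGraph V}
    [DecidableRel G.Adj] {A B : Finset V} {H : SimpleGraph W} [DecidableRel H.Adj] {S T : Finset W}
    {n : ℕ} (hn : 1 < n) {ε : ℝ} (hε0 : 0 < ε) (hε1 : ε < 1 / 2)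
    (hG : IsBigraph G A B) (hH : IsBigraph H S T)
    (hA : #A = n) (hB : #B = n) (hS : #S = n) (hT : #T = n)
    (hdG : ∀ x, x ∈ A ∨ x ∈ B → (1 / 2 + ε) * (n : ℝ) < (G.degree x : ℝ))
    (hdS : ∀ x ∈ S, (H.degree x : ℝ) < ε ^ 4 / 100 * ((n : ℝ) / Real.log n))
    (hdT : ∀ y ∈ T, H.degree y = 1) : IsBipartiteSubgraph H S T G A B := by
  classical
  have hex : ∀ t : T, ∃ s : S, ∀ x, H.Adj t x ↔ x = s := by
    intro t
    obtain ⟨s, hs⟩ := card_eq_one.1 (hdT t t.2)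
    have hiff : ∀ x, H.Adj t x ↔ x = s := fun x => by
      rw [← SimpleGraph.mem_neighborFinset, hs, mem_singleton]
    exact ⟨⟨s, hH.symm.mem_right_of_adj t.2 ((hiff s).2 rfl)⟩, hiff⟩
  choose c hc using hex
  obtain ⟨φ, ψ, hψ, hR⟩ := exists_star_embedding (S := S) (T := T) (A := A) (B := B) hn
    (by simpa using hS) (by simpa using hT) (by simpa using hA) (by simpa using hB) hε0 hε1
    (fun a b => G.Adj a b)
    (fun a => by rw [hG.card_filter_adj a.2]; exact hdG a (Or.inl a.2))
    (fun b => by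
      simp only [G.adj_comm _ (b : V)]
      rw [hG.symm.card_filter_adj b.2]; exact hdG b (Or.inr b.2))
    c (fun s => by
      have : #{t : T | c t = s} = H.degree s := by
        rw [← hH.card_filter_adj s.2]
        congr 1
        ext t
        simp only [mem_filter, mem_univ, true_and]
        rw [H.adj_comm, hc, Subtype.ext_iff, eq_comm]
      rw [this]; exact (hdS s s.2).le)
  have hTS : ∀ x, x ∉ S → x ∈ T := fun x hx => (hH.mem_or_mem x).resolve_left hx
  let f : W → V := fun x => if hx : x ∈ S then φ ⟨x, hx⟩ else ψ ⟨x, hTS x hx⟩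
  have hfS : ∀ s : S, f s = φ s := fun s => dif_pos s.2
  have hfT : ∀ t : T, f t = ψ t := fun t => dif_neg (hH.symm.notMem_right t.2)
  have hadj : ∀ t : T, ∀ x, H.Adj t x → G.Adj (f t) (f x) := by
    intro t x hx
    rw [(hc t x).1 hx, hfT, hfS]
    exact (hR t).symm
  refine ⟨⟨⟨f, fun {x y} hxy => ?_⟩, fun x y hxy => ?_⟩, fun s hs => ?_, fun t ht => ?_⟩
  · rcases hH.mem_or_mem x with hx | hx
    · exact (hadj ⟨y, hH.mem_right_of_adj hx hxy⟩ x hxy.symm).symm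
    · exact hadj ⟨x, hx⟩ y hxy
  · replace hxy : f x = f y := hxy
    rcases hH.mem_or_mem x with hx | hx <;> rcases hH.mem_or_mem y with hy | hy
    · rw [hfS ⟨x, hx⟩, hfS ⟨y, hy⟩] at hxy
      simpa using hxy
    · rw [hfS ⟨x, hx⟩, hfT ⟨y, hy⟩] at hxy
      exact (hG.notMem_right (φ ⟨x, hx⟩).2 (hxy ▸ (ψ ⟨y, hy⟩).2)).elim
    · rw [hfT ⟨x, hx⟩, hfS ⟨y, hy⟩] at hxy
      exact (hG.notMem_right (φ ⟨y, hy⟩).2 (hxy ▸ (ψ ⟨x, hx⟩).2)).elim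
    · rw [hfT ⟨x, hx⟩, hfT ⟨y, hy⟩] at hxy
      exact congrArg Subtype.val (hψ (Subtype.ext hxy))
  · change f s ∈ A
    rw [hfS ⟨s, hs⟩]; exact (φ ⟨s, hs⟩).2
  · change f t ∈ B
    rw [hfT ⟨t, ht⟩]; exact (ψ ⟨t, ht⟩).2

end BipartitePacking

theorem theorem1 (ε : ℝ) (hε0 : 0 < ε) (hε1 : ε < 1 / 2) :
    ∃ n₀ : ℕ, ∀ n : ℕ, n₀ < n →
      ∀ (V : Type*) [Fintype V] (W : Type*) [Fintype W]
        (G : SimpleGraph V) [DecidableRel G.Adj] (A B : Finset V)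
        (H : SimpleGraph W) [DecidableRel H.Adj] (S T : Finset W),
        BipartitePacking.IsBigraph G A B → BipartitePacking.IsBigraph H S T →
        A.card = n → B.card = n → S.card = n → T.card = n →
        (∀ x, x ∈ A ∨ x ∈ B → (1 / 2 + ε) * (n : ℝ) < (G.degree x : ℝ)) →
        (∀ x ∈ S, (H.degree x : ℝ) < ε ^ 4 / 100 * ((n : ℝ) / Real.log n)) →
        (∀ y ∈ T, H.degree y = 1) →
        BipartitePacking.IsBipartiteSubgraph H S T G A B ∧
        BipartitePacking.BipartitePack H S T
          (BipartitePacking.bipartiteCompl G A B) A B n n := by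
  -- The threshold does not depend on `ε`: the argument only needs `log n > 0`.
  refine ⟨1, fun n hn V _ W _ G _ A B H _ S T hG hH hA hB hS hT hdG hdS hdT => ?_⟩
  have h := BipartitePacking.isBipartiteSubgraph_of_degree hn hε0 hε1 hG hH hA hB hS hT hdG hdS hdT
  exact ⟨h, h.bipartitePack hG hH hA hB⟩
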